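/- Let $(M,D)$ be a compact metric space and let $C^0(M)$ be the space of continuous maps $M\to M$ with the distance $D_\infty(f,g)=\sup_{x\in M}D(f(x),g(x))$ and its Borel $\sigma$-algebra. Let $\mathcal F=\{f_i\}_{i\in\mathcal I}\subset C^0(M)$, where $\mathcal I$ is a measurable space such that $i\mapsto f_i$ is measurable, and let $\mu$ be a non-degenerate probability measure on $\mathcal I$, that is, for every $i\in\mathcal I$ and every neighborhood $U$ of $f_i$ in $C^0(M)$ one has $\mu(\{j: f_j\in U\})>0$. Let $\mu^{\mathbb N}$ be the product measure on $\mathcal I^{\mathbb N}$. For $\mathbf i=(i_1,i_2,\ldots)\in\mathcal I^{\mathbb N}$, $x\in M$ and $n\ge 1$ put $f_{\mathbf i}^n=f_{i_n}\circ\cdots\circ f_{i_1}$, $X_n^x(\mathbf i)=f_{\mathbf i}^n(x)$, and $f_{\mathbf i}^0=\mathrm{id}$, $X_0^x(\mathbf i)=x$. Assume: (P) (proximality) for all $x,y\in M$ there are $\mathbf i\in\mathcal I^{\mathbb N}$ and a sequence $(n_k)_{k}$ of natural numbers with $\lim_{k\to\infty}D(f_{\mathbf i}^{n_k}(x),f_{\mathbf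 i}^{n_k}(y))=0$; (LC) (local contraction with rate $q$) $q\in(0,1)$ is such that for every $x\in M$, for $\mu^{\mathbb N}$-almost every $\mathbf i\in\mathcal I^{\mathbb N}$, there is a neighborhood $B$ of $x$ with $\operatorname{diam}_D(f_{\mathbf i}^n(B))\le q^n$ for all $n\in\mathbb N$. Then for every $\alpha\in(0,1]$ there is $C>0$ such that for all $n\in\mathbb N$ \[ \sup_{x,y\in M}\ \sum_{k=0}^{n}\int D(X_k^x(\mathbf i),X_k^y(\mathbf i))^{\alpha}\,d\mu^{\mathbb N}(\mathbf i)\ \le\ C\sum_{k=0}^{n}q^{k\alpha}. \] -/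

import Mathlib

open MeasureTheory Set Filter Topology
open scoped ENNReal

/-- `f_𝐢^n = f_{i_n} ∘ ⋯ ∘ f_{i_1}`, with `f_𝐢^0 = id`; the sequence `𝐢 = (i_1, i_2, …)` is indexed
from `0` here, so `𝐢 0` is the first letter `i_1`. -/
def randomComp {M I : Type*} [TopologicalSpace M] (f : I → C(M, M)) (ω : ℕ → I) : ℕ → C(M, M)
  | 0 => ContinuousMap.id M
  | n + 1 => (f (ω n)).comp (randomComp f ω n)

/-- The random orbit `X_n^x(𝐢) = f_𝐢^n(x)`. -/
def randomOrbit {M I : Type*} [TopologicalSpace M] (f : I → C(M, M)) (x : M) (n : ℕ) (ω : ℕ → I) :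
    M :=
  randomComp f ω n x

/-- The product measure `μ^ℕ` on the space of sequences. -/
noncomputable def seqMeasure {I : Type*} [MeasurableSpace I] (μ : Measure I)
    [IsProbabilityMeasure μ] : Measure (ℕ → I) :=
  Measure.infinitePi (fun _ : ℕ => μ)

/-- `(ℱ, μ)` with `ℱ = {f_i}_{i ∈ I}` is a random dynamical system of continuous maps of the
compact metric space `M`. `C(M, M)` carries the topology of the supremum distance. -/
structure IsRDS {M I : Type*} [MetricSpace M] [CompactSpace M] [MeasurableSpace I]
    (f : I → C(M, M)) (μ : Measure I) [IsProbabilityMeasure μ] : Prop where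
  /-- `i ↦ f_i` is measurable for the Borel sigma-algebra of `C(M, M)`. -/
  measurable : @Measurable I C(M, M) _ (borel C(M, M)) f
  /-- `μ` is non-degenerate: every index `i` lies in the support of `μ`, i.e. every neighborhood
  of `f_i` in the supremum distance has positive measure. -/
  nondegenerate : ∀ i : I, ∀ U ∈ 𝓝 (f i), 0 < μ (f ⁻¹' U)

/-- `ℱ = {f_i}` is proximal. -/
def IsProximal {M I : Type*} [MetricSpace M] (f : I → C(M, M)) : Prop :=
  ∀ x y : M, ∃ ω : ℕ → I, ∃ n : ℕ → ℕ,
    Tendsto (fun k => dist (randomOrbit f x (n k) ω) (randomOrbit f y (n k) ω)) atTop (𝓝 0)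

/-- `q ∈ (0,1)` is a local contraction rate of `(ℱ, μ)`. -/
def IsLocalContractionRate {M I : Type*} [MetricSpace M] [MeasurableSpace I]
    (f : I → C(M, M)) (μ : Measure I) [IsProbabilityMeasure μ] (q : ℝ) : Prop :=
  q ∈ Ioo (0 : ℝ) 1 ∧
    ∀ x : M, ∀ᵐ ω ∂(seqMeasure μ), ∃ B ∈ 𝓝 x, ∀ n : ℕ,
      Metric.diam (randomComp f ω n '' B) ≤ q ^ n

/-!
The right-hand side is at least `C`, since its term `k = 0` is `1`; so the theorem amounts to a bound
on `∑_{k < n} E[D(X_k^x, X_k^y)^α]` (`pathSum`) which is uniform in `n`, `x` and `y`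
(`exists_pathSum_le`).

By compactness the two hypotheses become uniform. Local contraction gives `r > 0` such that two points
at distance less than `r` satisfy `D(X_k^x, X_k^y) ≤ q^k` for all `k` with probability at least `1/2`
(`IsLocalContractionRate.exists_escape_le_half`). Proximality and non-degeneracy give `N₀` and `p > 0`
such that any two points are `r`-close at some time `N ≤ N₀` with probability at least `p`
(`IsProximal.exists_uniform`).

Hence from any pair of points, after waiting `N` steps, the orbits contract at rate `q` forever with
probability at least `p / 2`. Up to the first violation of the contraction bound the accumulated
distance is at most a constant `c = N₀ diam(M)^α + ∑_k q^(kα)`, and after it the process starts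
afresh. If `A` is the supremum of the accumulated distance over pairs of points for a fixed time horizon, then
`A ≤ c + (1 - p / 2) A`, and as `A` is finite, `A ≤ 2 c / p`.

No stopping times appear: the restart is an induction on the horizon which uses only the Markov
property for one step, that is, the invariance of the product measure under prepending an independent
letter (`map_consSeq`). The lemmas doing this are `pathSum_le_geom_add_escape` for the contraction
regime and `pathSum_le_of_wait` for the waiting time.
-/

/-! ### Shifting the product measure -/

/-- The sequence `(i, ω 0, ω 1, …)`. -/
def consSeq {I : Type*} (i : I) (ω : ℕ → I) : ℕ → I
  | 0 => i
  | n + 1 => ω n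

lemma measurable_consSeq {I : Type*} [MeasurableSpace I] :
    Measurable fun p : I × (ℕ → I) => consSeq p.1 p.2 := by
  refine measurable_pi_iff.2 fun n => ?_
  cases n with
  | zero => exact measurable_fst
  | succ n => exact (measurable_pi_apply n).comp measurable_snd

instance isProbabilityMeasure_seqMeasure {I : Type*} [MeasurableSpace I] (μ : Measure I)
    [IsProbabilityMeasure μ] : IsProbabilityMeasure (seqMeasure μ) := by
  unfold seqMeasure; infer_instance

/-- Prepending an independent letter with law `μ` preserves the product measure. -/
lemma map_consSeq {I : Type*} [MeasurableSpace I] (μ : Measure I) [IsProbabilityMeasure μ] :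
    (μ.prod (seqMeasure μ)).map (fun p => consSeq p.1 p.2) = seqMeasure μ := by
  classical
  refine Measure.eq_infinitePi (fun _ : ℕ => μ) fun s t ht => ?_
  -- Enlarge `s` to an initial segment of `ℕ`, padding `t` with the whole space.
  set t' : ℕ → Set I := fun i => if i ∈ s then t i else univ with ht'
  have hm : ∀ i, MeasurableSet (t' i) := fun i => by
    simp only [ht']; split_ifs; exacts [ht i, MeasurableSet.univ]
  obtain ⟨N, hN⟩ : ∃ N, s ⊆ Finset.range (N + 1) :=
    ⟨s.sup id, fun i hi => Finset.mem_range.2 (Nat.lt_succ_of_le (Finset.le_sup (f := id) hi))⟩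
  have hpre : (fun p : I × (ℕ → I) => consSeq p.1 p.2) ⁻¹' (Set.pi s t)
      = t' 0 ×ˢ Set.pi (Finset.range N) (fun i => t' (i + 1)) := by
    ext ⟨i, ω⟩
    simp only [mem_preimage, Set.mem_pi, mem_prod, ht', Finset.coe_range, mem_Iio,
      Finset.mem_coe]
    constructor
    · intro h
      refine ⟨?_, fun k _ => ?_⟩
      · split_ifs with h0
        exacts [h 0 h0, mem_univ _]
      · split_ifs with h0
        exacts [h (k + 1) h0, mem_univ _]
    · rintro ⟨h0, h1⟩ k hk
      cases k with
      | zero =>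
        rw [if_pos hk] at h0
        exact h0
      | succ k =>
        have h2 := h1 k (by have := Finset.mem_range.1 (hN hk); omega)
        rw [if_pos hk] at h2
        exact h2
  have hprod : ∏ i ∈ s, μ (t i) = ∏ i ∈ Finset.range (N + 1), μ (t' i) := by
    rw [← Finset.prod_subset hN]
    · exact Finset.prod_congr rfl fun i hi => by simp [ht', hi]
    · intro i _ hi
      simp [ht', hi]
  rw [Measure.map_apply measurable_consSeq
    (MeasurableSet.pi s.countable_toSet fun i _ => ht i), hpre, Measure.prod_prod, hprod,
    Finset.prod_range_succ', mul_comm, seqMeasure,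
    Measure.infinitePi_pi _ fun i _ => hm (i + 1)]

lemma lintegral_seqMeasure_eq_consSeq {I : Type*} [MeasurableSpace I] (μ : Measure I)
    [IsProbabilityMeasure μ] {F : (ℕ → I) → ℝ≥0∞} (hF : Measurable F) :
    ∫⁻ ω, F ω ∂(seqMeasure μ) = ∫⁻ i, ∫⁻ ω, F (consSeq i ω) ∂(seqMeasure μ) ∂μ := by
  conv_lhs => rw [← map_consSeq μ]
  rw [lintegral_map hF measurable_consSeq]
  exact lintegral_prod _ (hF.comp measurable_consSeq).aemeasurable

lemma seqMeasure_apply_eq_consSeq {I : Type*} [MeasurableSpace I] (μ : Measure I)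
    [IsProbabilityMeasure μ] {s : Set (ℕ → I)} (hs : MeasurableSet s) :
    seqMeasure μ s = ∫⁻ i, seqMeasure μ (consSeq i ⁻¹' s) ∂μ := by
  conv_lhs => rw [← map_consSeq μ]
  rw [Measure.map_apply measurable_consSeq hs, Measure.prod_apply (measurable_consSeq hs)]
  rfl

/-! ### Accumulated distances and escape events of random orbits -/

section Orbits

variable {M I : Type*} [MetricSpace M]

lemma randomComp_consSeq (f : I → C(M, M)) (i : I) (ω : ℕ → I) (n : ℕ) :
    randomComp f (consSeq i ω) (n + 1) = (randomComp f ω n).comp (f i) := by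
  induction n with
  | zero => rfl
  | succ n ih =>
    rw [randomComp, ih]
    rfl

lemma randomOrbit_consSeq (f : I → C(M, M)) (x : M) (i : I) (ω : ℕ → I) (n : ℕ) :
    randomOrbit f x (n + 1) (consSeq i ω) = randomOrbit f (f i x) n ω := by
  rw [randomOrbit, randomComp_consSeq]
  rfl

@[simp] lemma randomOrbit_zero (f : I → C(M, M)) (x : M) (ω : ℕ → I) :
    randomOrbit f x 0 ω = x := rfl

/-- The expected accumulated distance `∑_{k < n} E[D(X_k^x, X_k^y)^α]`. -/
noncomputable def pathSum [MeasurableSpace I] (f : I → C(M, M)) (μ : Measure I)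
    [IsProbabilityMeasure μ] (α : ℝ) (n : ℕ) (x y : M) : ℝ≥0∞ :=
  ∑ k ∈ Finset.range n,
    ∫⁻ ω, ENNReal.ofReal (dist (randomOrbit f x k ω) (randomOrbit f y k ω) ^ α) ∂(seqMeasure μ)

lemma pathSum_mono [MeasurableSpace I] (f : I → C(M, M)) (μ : Measure I)
    [IsProbabilityMeasure μ] (α : ℝ) (x y : M) : Monotone fun n => pathSum f μ α n x y := fun _ _ h =>
  Finset.sum_le_sum_of_subset (Finset.range_mono h)

/-- The event that the orbits of `x` and `y` violate the bound `D(X_k^x, X_k^y) ≤ q^(j+k)` at some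
time `k < n`. The offset `j` makes the family stable under shifting time by one. -/
def escapeSet (f : I → C(M, M)) (q : ℝ) (j n : ℕ) (x y : M) : Set (ℕ → I) :=
  {ω | ∃ k < n, q ^ (j + k) < dist (randomOrbit f x k ω) (randomOrbit f y k ω)}

lemma consSeq_preimage_escapeSet {f : I → C(M, M)} {q : ℝ} {j : ℕ} {x y : M}
    (h : dist x y ≤ q ^ j) (n : ℕ) (i : I) :
    consSeq i ⁻¹' escapeSet f q j (n + 1) x y = escapeSet f q (j + 1) n (f i x) (f i y) := by
  ext ω
  simp only [escapeSet, mem_preimage, mem_ofPred_eq]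
  constructor
  · rintro ⟨k, hk, hlt⟩
    cases k with
    | zero => exact absurd hlt (not_lt.2 (by simpa using h))
    | succ k =>
      refine ⟨k, by omega, ?_⟩
      rwa [randomOrbit_consSeq, randomOrbit_consSeq, show j + (k + 1) = j + 1 + k by ring] at hlt
  · rintro ⟨k, hk, hlt⟩
    refine ⟨k + 1, by omega, ?_⟩
    rwa [randomOrbit_consSeq, randomOrbit_consSeq, show j + (k + 1) = j + 1 + k by ring]

/-! ### Measurability of random orbits -/

variable [CompactSpace M] [MeasurableSpace I] {f : I → C(M, M)}

lemma measurable_randomComp (hf : @Measurable I C(M, M) _ (borel C(M, M)) f) (n : ℕ) :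
    @Measurable (ℕ → I) C(M, M) _ (borel C(M, M)) fun ω => randomComp f ω n := by
  let _ : MeasurableSpace C(M, M) := borel C(M, M)
  have _ : BorelSpace C(M, M) := ⟨rfl⟩
  induction n with
  | zero => exact measurable_const
  | succ n ih =>
    exact ContinuousMap.continuous_comp'.measurable.comp
      (ih.prodMk (hf.comp (measurable_pi_apply n)))

lemma measurable_dist_randomOrbit (hf : @Measurable I C(M, M) _ (borel C(M, M)) f)
    (x y : M) (n : ℕ) :
    Measurable fun ω : ℕ → I => dist (randomOrbit f x n ω) (randomOrbit f y n ω) := by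
  let _ : MeasurableSpace C(M, M) := borel C(M, M)
  have _ : BorelSpace C(M, M) := ⟨rfl⟩
  have hc : Continuous fun g : C(M, M) => dist (g x) (g y) := by fun_prop
  exact hc.measurable.comp (measurable_randomComp hf n)

lemma measurableSet_le_dist_randomOrbit (hf : @Measurable I C(M, M) _ (borel C(M, M)) f)
    (r : ℝ) (x y : M) (n : ℕ) :
    MeasurableSet {ω : ℕ → I | r ≤ dist (randomOrbit f x n ω) (randomOrbit f y n ω)} :=
  measurableSet_le measurable_const (measurable_dist_randomOrbit hf x y n)

lemma seqMeasure_le_dist_succ (hf : @Measurable I C(M, M) _ (borel C(M, M)) f)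
    (μ : Measure I) [IsProbabilityMeasure μ] (r : ℝ) (x y : M) (n : ℕ) :
    seqMeasure μ {ω | r ≤ dist (randomOrbit f x (n + 1) ω) (randomOrbit f y (n + 1) ω)}
      = ∫⁻ i, seqMeasure μ
          {ω | r ≤ dist (randomOrbit f (f i x) n ω) (randomOrbit f (f i y) n ω)} ∂μ := by
  rw [seqMeasure_apply_eq_consSeq μ (measurableSet_le_dist_randomOrbit hf r x y (n + 1))]
  simp only [preimage_ofPred_eq, randomOrbit_consSeq]

/-! ### Bounds on accumulated distances -/

/-- Markov property at time `1`. -/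
lemma pathSum_succ (hf : @Measurable I C(M, M) _ (borel C(M, M)) f)
    (μ : Measure I) [IsProbabilityMeasure μ] (α : ℝ) (n : ℕ) (x y : M) :
    pathSum f μ α (n + 1) x y
      = ENNReal.ofReal (dist x y ^ α) + ∫⁻ i, pathSum f μ α n (f i x) (f i y) ∂μ := by
  have hm : ∀ k, Measurable fun ω : ℕ → I =>
      ENNReal.ofReal (dist (randomOrbit f x k ω) (randomOrbit f y k ω) ^ α) := fun k =>
    ((measurable_dist_randomOrbit hf x y k).pow_const α).ennreal_ofReal
  have hm' : ∀ k, Measurable fun i : I => ∫⁻ ω, ENNReal.ofReal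
      (dist (randomOrbit f (f i x) k ω) (randomOrbit f (f i y) k ω) ^ α) ∂(seqMeasure μ) := by
    intro k
    have := ((hm (k + 1)).comp measurable_consSeq).lintegral_prod_right' (ν := seqMeasure μ)
    simpa only [Function.comp_apply, randomOrbit_consSeq] using this
  unfold pathSum
  rw [Finset.sum_range_succ', lintegral_finsetSum _ fun k _ => hm' k, add_comm]
  congr 1
  · simp
  · refine Finset.sum_congr rfl fun k _ => ?_
    rw [lintegral_seqMeasure_eq_consSeq μ (hm (k + 1))]
    simp only [randomOrbit_consSeq]

lemma ofReal_dist_rpow_le_diam {α : ℝ} (hα : 0 ≤ α) (x y : M) :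
    ENNReal.ofReal (dist x y ^ α) ≤ ENNReal.ofReal (Metric.diam (univ : Set M) ^ α) :=
  ENNReal.ofReal_le_ofReal <| Real.rpow_le_rpow dist_nonneg
    (Metric.dist_le_diam_of_mem isCompact_univ.isBounded (mem_univ x) (mem_univ y)) hα

lemma pathSum_le_mul_diam (μ : Measure I) [IsProbabilityMeasure μ] {α : ℝ} (hα : 0 ≤ α)
    (n : ℕ) (x y : M) :
    pathSum f μ α n x y ≤ n * ENNReal.ofReal (Metric.diam (univ : Set M) ^ α) := by
  have : ∀ k ∈ Finset.range n,
      ∫⁻ ω, ENNReal.ofReal (dist (randomOrbit f x k ω) (randomOrbit f y k ω) ^ α)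
        ∂(seqMeasure μ) ≤ ENNReal.ofReal (Metric.diam (univ : Set M) ^ α) := fun k _ =>
    (lintegral_mono fun ω => ofReal_dist_rpow_le_diam hα _ _).trans (by simp)
  simpa [pathSum] using Finset.sum_le_card_nsmul _ _ _ this

/-- Waiting for `N` steps before applying a bound that depends on whether the two points are
`r`-close costs at most `N` diameters. -/
lemma pathSum_le_of_wait (hf : @Measurable I C(M, M) _ (borel C(M, M)) f)
    (μ : Measure I) [IsProbabilityMeasure μ] {α : ℝ} (hα : 0 ≤ α) (r : ℝ) (n : ℕ)
    {c b : ℝ≥0∞} (hb : b ≠ ∞)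
    (h : ∀ x y : M, pathSum f μ α n x y ≤ c + b * (if r ≤ dist x y then 1 else 0))
    (N : ℕ) (x y : M) :
    pathSum f μ α n x y ≤ N * ENNReal.ofReal (Metric.diam (univ : Set M) ^ α) + c +
      b * seqMeasure μ {ω | r ≤ dist (randomOrbit f x N ω) (randomOrbit f y N ω)} := by
  induction N generalizing x y with
  | zero =>
    refine (h x y).trans_eq ?_
    by_cases hr : r ≤ dist x y <;> simp [hr]
  | succ N ih =>
    set Δ := ENNReal.ofReal (Metric.diam (univ : Set M) ^ α) with hΔ
    calc pathSum f μ α n x y ≤ pathSum f μ α (n + 1) x y := pathSum_mono f μ α x y n.le_succ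
      _ = ENNReal.ofReal (dist x y ^ α) + ∫⁻ i, pathSum f μ α n (f i x) (f i y) ∂μ :=
        pathSum_succ hf μ α n x y
      _ ≤ Δ + ∫⁻ i, (N * Δ + c + b * seqMeasure μ
          {ω | r ≤ dist (randomOrbit f (f i x) N ω) (randomOrbit f (f i y) N ω)}) ∂μ :=
        add_le_add (ofReal_dist_rpow_le_diam hα x y) (lintegral_mono fun i => ih _ _)
      _ = _ := by
        rw [lintegral_add_left measurable_const, lintegral_const_mul' _ _ hb,
          ← seqMeasure_le_dist_succ hf μ r x y N, lintegral_const, measure_univ, mul_one]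
        push_cast
        ring

/-! ### The contraction regime -/

lemma measurableSet_escapeSet (hf : @Measurable I C(M, M) _ (borel C(M, M)) f) (q : ℝ)
    (j n : ℕ) (x y : M) : MeasurableSet (escapeSet f q j n x y) := by
  have : escapeSet f q j n x y = ⋃ k, ⋃ (_ : k < n),
      {ω | q ^ (j + k) < dist (randomOrbit f x k ω) (randomOrbit f y k ω)} := by
    ext ω; simp [escapeSet]
  rw [this]
  exact MeasurableSet.iUnion fun k => MeasurableSet.iUnion fun _ =>
    measurableSet_lt measurable_const (measurable_dist_randomOrbit hf x y k)

/-- Along orbits that stay in the contraction regime the accumulated distance is at most a geometric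
sum; at the first violation the process starts afresh, which costs at most `A`. -/
lemma pathSum_le_geom_add_escape (hf : @Measurable I C(M, M) _ (borel C(M, M)) f)
    (μ : Measure I) [IsProbabilityMeasure μ] {α q : ℝ} (hα : 0 ≤ α) (hq : 0 ≤ q)
    {A : ℝ≥0∞} (hA : A ≠ ∞) (n : ℕ)
    (h : ∀ x y : M, pathSum f μ α n x y ≤ A) (j : ℕ) (x y : M) :
    pathSum f μ α n x y ≤ ∑ k ∈ Finset.range n, ENNReal.ofReal (q ^ α) ^ (j + k) +
      A * seqMeasure μ (escapeSet f q j n x y) := by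
  induction n generalizing j x y with
  | zero => simp [pathSum]
  | succ n ih =>
    by_cases hxy : dist x y ≤ q ^ j
    · have h' : ∀ x y : M, pathSum f μ α n x y ≤ A := fun x y =>
        (pathSum_mono f μ α x y n.le_succ).trans (h x y)
      have h0 : ENNReal.ofReal (dist x y ^ α) ≤ ENNReal.ofReal (q ^ α) ^ j := by
        rw [← ENNReal.ofReal_pow (Real.rpow_nonneg hq α), ← Real.rpow_natCast, ← Real.rpow_mul hq,
          mul_comm, Real.rpow_mul hq, Real.rpow_natCast]
        exact ENNReal.ofReal_le_ofReal (Real.rpow_le_rpow dist_nonneg hxy hα)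
      calc pathSum f μ α (n + 1) x y
          = ENNReal.ofReal (dist x y ^ α) + ∫⁻ i, pathSum f μ α n (f i x) (f i y) ∂μ :=
            pathSum_succ hf μ α n x y
        _ ≤ ENNReal.ofReal (q ^ α) ^ j +
            ∫⁻ i, (∑ k ∈ Finset.range n, ENNReal.ofReal (q ^ α) ^ (j + 1 + k) +
              A * seqMeasure μ (escapeSet f q (j + 1) n (f i x) (f i y))) ∂μ :=
            add_le_add h0 (lintegral_mono fun i => ih h' (j + 1) _ _)
        _ = _ := by
            rw [lintegral_add_left measurable_const, lintegral_const_mul' _ _ hA,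
              seqMeasure_apply_eq_consSeq μ (measurableSet_escapeSet hf q j (n + 1) x y)]
            simp only [consSeq_preimage_escapeSet hxy]
            rw [lintegral_const, measure_univ, mul_one, Finset.sum_range_succ', ← add_assoc,
              add_comm (ENNReal.ofReal (q ^ α) ^ j)]
            simp only [add_zero, add_right_comm j 1, add_assoc]
    · have : escapeSet f q j (n + 1) x y = univ :=
        eq_univ_of_forall fun ω => ⟨0, n.succ_pos, by simpa using hxy⟩
      rw [this, measure_univ, mul_one]
      exact (h x y).trans le_add_self

/-- Uniform form of local contraction: nearby points leave the contraction regime with probability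
at most `1 / 2`. -/
lemma IsLocalContractionRate.exists_escape_le_half
    (hf : @Measurable I C(M, M) _ (borel C(M, M)) f)
    {μ : Measure I} [IsProbabilityMeasure μ] {q : ℝ} (hLC : IsLocalContractionRate f μ q) :
    ∃ r > 0, ∀ x y : M, dist x y < r → ∀ n,
      seqMeasure μ (escapeSet f q 0 n x y) ≤ 2⁻¹ := by
  set G : M → ℕ → Set (ℕ → I) := fun x m =>
    {ω | ∀ n, Metric.diam (randomComp f ω n '' Metric.ball x (1 / ((m : ℝ) + 1))) ≤ q ^ n} with hG
  have hbdd : ∀ s : Set M, Bornology.IsBounded s := fun s =>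
    isCompact_univ.isBounded.subset (subset_univ s)
  -- Measurability of `G x m` is not needed: continuity from below holds for the outer measure.
  have key : ∀ x, ∃ m, 2⁻¹ < seqMeasure μ (G x m) := by
    intro x
    have hmono : Monotone (G x) := by
      intro m m' hmm ω hω n
      refine (Metric.diam_mono (image_mono (Metric.ball_subset_ball ?_)) (hbdd _)).trans (hω n)
      exact Nat.one_div_le_one_div hmm
    have hone : seqMeasure μ (⋃ m, G x m) = 1 := by
      rw [← measure_univ (μ := seqMeasure μ)]
      refine measure_congr (eventuallyEq_univ.2 ?_)
      filter_upwards [hLC.2 x] with ω ⟨B, hB, hdiam⟩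
      obtain ⟨ε, hε, hball⟩ := Metric.mem_nhds_iff.1 hB
      obtain ⟨m, hm⟩ := exists_nat_one_div_lt hε
      refine mem_iUnion.2 ⟨m, fun n => ?_⟩
      exact (Metric.diam_mono (image_mono ((Metric.ball_subset_ball hm.le).trans hball))
        (hbdd _)).trans (hdiam n)
    rw [hmono.measure_iUnion] at hone
    refine lt_iSup_iff.1 ?_
    rw [hone]
    exact ENNReal.inv_lt_one.2 (by norm_num)
  choose m hm using key
  obtain ⟨r, hr, hcov⟩ := lebesgue_number_lemma_of_metric (isCompact_univ (X := M))
    (c := fun z : M => Metric.ball z (1 / ((m z : ℝ) + 1))) (fun z => Metric.isOpen_ball)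
    (fun x _ => mem_iUnion.2 ⟨x, Metric.mem_ball_self Nat.one_div_pos_of_nat⟩)
  refine ⟨r, hr, fun x y hxy n => ?_⟩
  obtain ⟨z, hz⟩ := hcov x (mem_univ x)
  have hsub : G z (m z) ⊆ (escapeSet f q 0 n x y)ᶜ := by
    rintro ω hω ⟨k, -, hlt⟩
    refine absurd hlt (not_lt.2 ?_)
    rw [zero_add]
    exact (Metric.dist_le_diam_of_mem (hbdd _)
      (mem_image_of_mem _ (hz (Metric.mem_ball_self hr)))
      (mem_image_of_mem _ (hz (Metric.mem_ball'.2 hxy)))).trans (hω k)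
  have hcompl := (hm z).le.trans (measure_mono hsub)
  have hle := prob_compl_le_one_sub_of_le_prob hcompl
    (measurableSet_escapeSet hf q 0 n x y).compl
  rwa [compl_compl, ENNReal.one_sub_inv_two] at hle

/-! ### Uniform proximality -/

/-- If one sequence brings `x` and `y` within `r` of each other at time `n`, then by non-degeneracy
this happens with probability bounded below, uniformly for starting points near `(x, y)`. -/
lemma IsRDS.exists_prob_dist_lt (μ : Measure I) [IsProbabilityMeasure μ] (hRDS : IsRDS f μ)
    (r : ℝ) (n : ℕ) (ω : ℕ → I) (x y : M)
    (h : dist (randomOrbit f x n ω) (randomOrbit f y n ω) < r) :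
    ∃ p : ℝ≥0∞, p ≠ 0 ∧ ∀ᶠ z in 𝓝 (x, y),
      seqMeasure μ {ω | r ≤ dist (randomOrbit f z.1 n ω) (randomOrbit f z.2 n ω)} + p ≤ 1 := by
  induction n generalizing ω x y with
  | zero =>
    refine ⟨1, one_ne_zero, ?_⟩
    have hopen : IsOpen {z : M × M | dist z.1 z.2 < r} :=
      isOpen_lt (by fun_prop) continuous_const
    filter_upwards [hopen.mem_nhds h] with z hz
    simp [not_le.2 hz]
  | succ n ih =>
    have hω : ω = consSeq (ω 0) (fun k => ω (k + 1)) := by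
      funext k
      cases k <;> rfl
    rw [hω, randomOrbit_consSeq, randomOrbit_consSeq] at h
    obtain ⟨p, hp, hev⟩ := ih _ _ _ h
    have hcont : Continuous fun w : C(M, M) × (M × M) => (w.1 w.2.1, w.1 w.2.2) := by fun_prop
    have hpre := hcont.continuousAt (x := (f (ω 0), (x, y))) hev
    obtain ⟨V, W, hVo, hV, hWo, hW, hVW⟩ := mem_nhds_prod_iff'.1 hpre
    have hVm : MeasurableSet (f ⁻¹' V) :=
      hRDS.measurable (MeasurableSpace.measurableSet_generateFrom hVo)
    refine ⟨p * μ (f ⁻¹' V),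
      mul_ne_zero hp (hRDS.nondegenerate (ω 0) V (hVo.mem_nhds hV)).ne', ?_⟩
    filter_upwards [hWo.mem_nhds hW] with z hz
    rw [seqMeasure_le_dist_succ hRDS.measurable, ← lintegral_indicator_const hVm p,
      ← lintegral_add_right _ (measurable_const.indicator hVm)]
    refine (lintegral_mono (g := fun _ => 1) fun i => ?_).trans (by simp)
    by_cases hi : i ∈ f ⁻¹' V
    · rw [indicator_of_mem hi]
      exact hVW (mk_mem_prod (show f i ∈ V from hi) hz)
    · rw [indicator_of_notMem hi, add_zero]
      exact prob_le_one

/-- Any two points come within `r` of each other at some time `N ≤ N₀`, with probability at least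
`p`, where `N₀` and `p` do not depend on the points. -/
lemma IsProximal.exists_uniform (μ : Measure I) [IsProbabilityMeasure μ] (hRDS : IsRDS f μ)
    (hP : IsProximal f) {r : ℝ} (hr : 0 < r) :
    ∃ (N₀ : ℕ) (p : ℝ≥0∞), p ≠ 0 ∧ ∀ x y : M, ∃ N ≤ N₀,
      seqMeasure μ {ω | r ≤ dist (randomOrbit f x N ω) (randomOrbit f y N ω)} + p ≤ 1 := by
  suffices h : ∃ (N₀ : ℕ) (p : ℝ≥0∞), p ≠ 0 ∧ ∀ z ∈ (univ : Set (M × M)), ∃ N ≤ N₀,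
      seqMeasure μ {ω | r ≤ dist (randomOrbit f z.1 N ω) (randomOrbit f z.2 N ω)} + p ≤ 1 by
    obtain ⟨N₀, p, hp, h⟩ := h
    exact ⟨N₀, p, hp, fun x y => h (x, y) (mem_univ _)⟩
  refine isCompact_univ.induction_on (p := fun S : Set (M × M) => ∃ (N₀ : ℕ) (p : ℝ≥0∞),
    p ≠ 0 ∧ ∀ z ∈ S, ∃ N ≤ N₀, seqMeasure μ
      {ω | r ≤ dist (randomOrbit f z.1 N ω) (randomOrbit f z.2 N ω)} + p ≤ 1) ?_ ?_ ?_ ?_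
  · exact ⟨0, 1, one_ne_zero, fun z hz => absurd hz (notMem_empty z)⟩
  · rintro S T hST ⟨N₀, p, hp, h⟩
    exact ⟨N₀, p, hp, fun z hz => h z (hST hz)⟩
  · rintro S T ⟨N₁, p₁, hp₁, h₁⟩ ⟨N₂, p₂, hp₂, h₂⟩
    refine ⟨max N₁ N₂, min p₁ p₂, (lt_min hp₁.bot_lt hp₂.bot_lt).ne', ?_⟩
    rintro z (hz | hz)
    · obtain ⟨N, hN, h⟩ := h₁ z hz
      exact ⟨N, hN.trans (le_max_left _ _), (add_le_add_right (min_le_left _ _) _).trans h⟩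
    · obtain ⟨N, hN, h⟩ := h₂ z hz
      exact ⟨N, hN.trans (le_max_right _ _), (add_le_add_right (min_le_right _ _) _).trans h⟩
  · rintro ⟨x, y⟩ -
    obtain ⟨ω, n, hn⟩ := hP x y
    obtain ⟨k, hk⟩ := (hn.eventually (gt_mem_nhds hr)).exists
    obtain ⟨p, hp, hev⟩ := hRDS.exists_prob_dist_lt μ r (n k) ω x y hk
    exact ⟨_, mem_nhdsWithin_of_mem_nhds hev, n k, p, hp, fun z hz => ⟨n k, le_rfl, hz⟩⟩

/-! ### Summability -/

lemma le_of_le_add_half_mul {A c v p : ℝ≥0∞} (hA : A ≠ ∞) (hp : p ≠ 0)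
    (h : A ≤ c + A * 2⁻¹ + A * 2⁻¹ * v) (hv : v + p ≤ 1) : A ≤ 2 * c / p := by
  have hvp : v + p ≠ ∞ := ne_top_of_le_ne_top ENNReal.one_ne_top hv
  obtain ⟨hv', hp'⟩ := ENNReal.add_ne_top.1 hvp
  rcases eq_or_ne c ∞ with rfl | hc
  · simp [ENNReal.top_div_of_ne_top hp']
  rw [ENNReal.le_div_iff_mul_le (Or.inl hp) (Or.inl hp')]
  lift A to NNReal using hA
  lift c to NNReal using hc
  lift v to NNReal using hv'
  lift p to NNReal using hp'
  have h2 : ((2 : NNReal) : ℝ≥0∞)⁻¹ = ((2⁻¹ : NNReal) : ℝ≥0∞) :=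
    (ENNReal.coe_inv two_ne_zero).symm
  rw [ENNReal.coe_ofNat] at h2
  rw [h2] at h
  norm_cast at h hv ⊢
  have h' : (A : ℝ) ≤ c + A * 2⁻¹ + A * 2⁻¹ * v := by exact_mod_cast h
  have hv'' : (v : ℝ) + p ≤ 1 := by exact_mod_cast hv
  have : (A : ℝ) * p ≤ 2 * c := by nlinarith [A.2, mul_nonneg A.2 (sub_nonneg.2 hv'')]
  exact_mod_cast this

/-- The expected accumulated distance is bounded uniformly in time and in the starting points. -/
lemma exists_pathSum_le (μ : Measure I) [IsProbabilityMeasure μ] (hRDS : IsRDS f μ)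
    (hP : IsProximal f) {q : ℝ} (hLC : IsLocalContractionRate f μ q) {α : ℝ} (hα : 0 < α) :
    ∃ C : ℝ≥0∞, C ≠ ∞ ∧ ∀ (n : ℕ) (x y : M), pathSum f μ α n x y ≤ C := by
  have hf := hRDS.measurable
  have hq := hLC.1
  obtain ⟨r, hr, hesc⟩ := hLC.exists_escape_le_half hf
  obtain ⟨N₀, p, hp, hprox⟩ := hP.exists_uniform μ hRDS hr
  set Δ := ENNReal.ofReal (Metric.diam (univ : Set M) ^ α) with hΔ
  set K : ℝ≥0∞ := (1 - ENNReal.ofReal (q ^ α))⁻¹ with hK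
  have hKtop : K ≠ ∞ := by
    refine ENNReal.inv_ne_top.2 (tsub_pos_of_lt ?_).ne'
    exact ENNReal.ofReal_lt_one.2 (Real.rpow_lt_one hq.1.le hq.2 hα)
  refine ⟨2 * (N₀ * Δ + K) / p, ENNReal.div_ne_top (ENNReal.mul_ne_top ENNReal.ofNat_ne_top
    (ENNReal.add_ne_top.2 ⟨ENNReal.mul_ne_top (ENNReal.natCast_ne_top _) ENNReal.ofReal_ne_top,
      hKtop⟩)) hp, fun n x₀ y₀ => ?_⟩
  set A : ℝ≥0∞ := ⨆ x : M, ⨆ y : M, pathSum f μ α n x y with hAdef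
  have hle : ∀ x y : M, pathSum f μ α n x y ≤ A := fun x y =>
    le_iSup₂ (f := fun x y : M => pathSum f μ α n x y) x y
  have hA : A ≠ ∞ := ne_top_of_le_ne_top
    (ENNReal.mul_ne_top (ENNReal.natCast_ne_top n) (ENNReal.ofReal_ne_top (r := _)))
    (iSup₂_le fun x y => pathSum_le_mul_diam μ hα.le n x y)
  have hA2 : A * 2⁻¹ ≠ ∞ := ENNReal.mul_ne_top hA (by simp)
  have hgeom : ∑ k ∈ Finset.range n, ENNReal.ofReal (q ^ α) ^ (0 + k) ≤ K := by
    simp only [zero_add, hK, ← ENNReal.tsum_geometric]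
    exact ENNReal.sum_le_tsum _
  -- For points at distance at least `r` the two halves of `A` add up to the trivial bound.
  have hclose : ∀ x y : M, pathSum f μ α n x y ≤
      (K + A * 2⁻¹) + A * 2⁻¹ * (if r ≤ dist x y then 1 else 0) := by
    intro x y
    split_ifs with hxy
    · rw [mul_one, add_assoc, ← mul_add, ENNReal.inv_two_add_inv_two, mul_one]
      exact (hle x y).trans le_add_self
    · rw [mul_zero, add_zero]
      refine (pathSum_le_geom_add_escape hf μ hα.le hq.1.le hA n hle 0 x y).trans ?_
      gcongr
      exact hesc x y (not_le.1 hxy) n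
  obtain ⟨v, hv, hAv⟩ : ∃ v : ℝ≥0∞, v + p ≤ 1 ∧
      A ≤ (N₀ * Δ + K) + A * 2⁻¹ + A * 2⁻¹ * v := by
    have hp1 : p ≤ 1 := by
      obtain ⟨N, -, hN⟩ := hprox x₀ y₀
      exact le_add_self.trans hN
    refine ⟨1 - p, (tsub_add_cancel_of_le hp1).le, iSup₂_le fun x y => ?_⟩
    obtain ⟨N, hN, hNp⟩ := hprox x y
    refine (pathSum_le_of_wait hf μ hα.le r n hA2 hclose N x y).trans ?_
    rw [add_assoc (N₀ * Δ : ℝ≥0∞)]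
    gcongr
    exact ENNReal.le_sub_of_add_le_right (ne_top_of_le_ne_top ENNReal.one_ne_top hp1) hNp
  exact (hle x₀ y₀).trans (le_of_le_add_half_mul hA hp hAv hv)

end Orbits

theorem theorem1p2 {M I : Type*} [MetricSpace M] [CompactSpace M] [MeasurableSpace I]
    (f : I → C(M, M)) (μ : Measure I) [IsProbabilityMeasure μ] (hRDS : IsRDS f μ)
    (hP : IsProximal f) (q : ℝ) (hLC : IsLocalContractionRate f μ q)
    (α : ℝ) (hα : α ∈ Set.Ioc (0 : ℝ) 1) :
    ∃ C : ℝ, 0 < C ∧ ∀ n : ℕ,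
      (⨆ x : M, ⨆ y : M, ∑ k ∈ Finset.range (n + 1),
          ∫⁻ ω, ENNReal.ofReal (dist (randomOrbit f x k ω) (randomOrbit f y k ω) ^ α)
            ∂(seqMeasure μ))
        ≤ ENNReal.ofReal (C * ∑ k ∈ Finset.range (n + 1), q ^ ((k : ℝ) * α)) := by
  obtain ⟨C, hC, hle⟩ := exists_pathSum_le μ hRDS hP hLC hα.1
  have hq := hLC.1.1
  refine ⟨C.toReal + 1, by positivity, fun n => iSup₂_le fun x y => ?_⟩
  -- The term `k = 0` of the geometric sum is `1`, so a uniform bound suffices.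
  have hsum : 1 ≤ ∑ k ∈ Finset.range (n + 1), q ^ ((k : ℝ) * α) := by
    rw [Finset.sum_range_succ']
    simpa using Finset.sum_nonneg fun k (_ : k ∈ Finset.range n) =>
      Real.rpow_nonneg hq.le (((k + 1 : ℕ) : ℝ) * α)
  calc _ ≤ C := hle (n + 1) x y
    _ = ENNReal.ofReal C.toReal := (ENNReal.ofReal_toReal hC).symm
    _ ≤ _ := ENNReal.ofReal_le_ofReal (by nlinarith [C.toReal_nonneg])
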